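/- Let $G$ be a countable group acting on a Lebesgue space $(X,m)$, that is, a standard Borel space $X$ with (the completion of) a Borel probability measure $m$. Suppose that the action is by measure class preserving transformations: every map $x\mapsto gx$ is measurable with respect to the completed $\sigma$-algebra, and every image measure $gm$ is equivalent to $m$. Suppose also that the action is free (mod $0$): for $m$-almost every $x$, the equality $gx=x$ holds only for $g=e$. Let $\mathcal I$ be the $\sigma$-algebra of (mod $0$) $G$-invariant measurable sets. Let $m_x$, $x\in X$, be the regular conditional probabilities of $m$ given $\mathcal I$, so that $m_x$ is the conditional measure of the ergodic component containing $x$. The continual part $\mathcal C$ of the action is the union of the purely non-atomic ergodic components, i.e. the set of $x$ such that $m_x(\{y\})=0$ for all $y\in X$. The discontinual part $\mathcal D$ is the union of the purely atomic ergodic components, i.e. the set of $x$ such that $m_x$ is concentrated on a countable set. Then, up to $m$-null sets, $$\mathcal C=\Big\{x\in X:\ \sum_{g\in G}\frac{d\,gm}{dm}(x)=\infty\Big\}\qquad\text{and}\qquad \mathcal D=\Big\{x\in X:\ \sum_{g\in G}\frac{d\,gm}{dm}(x)<\infty\Big\}.$$ -/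

import Mathlib

open MeasureTheory ProbabilityTheory
open scoped ENNReal

/-- The action of `G` on the Lebesgue space `(X, m)` is by measure class preserving transformations:
every `x ↦ g • x` is measurable with respect to the `m`-completion of the σ-algebra of `X`, and the
image measure `g m` is absolutely continuous with respect to `m` (applying this to `g⁻¹` as well,
`g m` is equivalent to `m`). -/
structure IsNonsingularAction (G : Type*) {X : Type*} [Group G] [MulAction G X]
    [MeasurableSpace X] (m : Measure X) : Prop where
  aemeasurable_smul : ∀ g : G, AEMeasurable (fun x : X => g • x) m
  map_smul_absolutelyContinuous : ∀ g : G, m.map (fun x : X => g • x) ≪ m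

/-- The action is free (mod 0): almost every point has trivial stabilizer. -/
def IsFreeAction (G : Type*) {X : Type*} [Group G] [MulAction G X]
    [MeasurableSpace X] (m : Measure X) : Prop :=
  ∀ᵐ x ∂m, ∀ g : G, g • x = x → g = 1

/-- The σ-algebra of (mod 0) `G`-invariant measurable sets. -/
@[reducible] def invariantSets (G : Type*) {X : Type*} [Group G] [MulAction G X]
    [MeasurableSpace X] (m : Measure X) : MeasurableSpace X where
  MeasurableSet' s := MeasurableSet s ∧ ∀ g : G, (fun x : X => g • x) ⁻¹' s =ᵐ[m] s
  measurableSet_empty := ⟨MeasurableSet.empty, fun _ => by simp⟩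
  measurableSet_compl s hs := ⟨hs.1.compl, fun g => (hs.2 g).compl⟩
  measurableSet_iUnion s hs := by
    refine ⟨MeasurableSet.iUnion fun n => (hs n).1, fun g => ?_⟩
    rw [Set.preimage_iUnion]
    exact Filter.EventuallyEq.countable_iUnion fun n => (hs n).2 g

/-- The conditional probability measure carried by the ergodic component that contains `x`, that is,
the regular conditional probability of `m` given the σ-algebra of invariant sets. It depends on `x`
only through the image of `x` in the space of ergodic components. -/
noncomputable def ergodicComponent (G : Type*) {X : Type*} [Group G] [MulAction G X]
    [MeasurableSpace X] [StandardBorelSpace X] (m : Measure X) [IsFiniteMeasure m] (x : X) :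
    Measure X :=
  condExpKernel m (invariantSets G m) x

/-- A measure is purely atomic if it is concentrated on a countable set of points. -/
def IsPurelyAtomic {X : Type*} [MeasurableSpace X] (μ : Measure X) : Prop :=
  ∃ S : Set X, S.Countable ∧ μ Sᶜ = 0

/-- The continual part of the action: the union of the purely non-atomic ergodic components,
those whose conditional measure gives measure zero to every point. -/
def continualPart (G : Type*) {X : Type*} [Group G] [MulAction G X]
    [MeasurableSpace X] [StandardBorelSpace X] (m : Measure X) [IsFiniteMeasure m] : Set X :=
  {x | NullSingletonClass (ergodicComponent G m x)}

/-- The discontinual part of the action: the union of the purely atomic ergodic components. -/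
def discontinualPart (G : Type*) {X : Type*} [Group G] [MulAction G X]
    [MeasurableSpace X] [StandardBorelSpace X] (m : Measure X) [IsFiniteMeasure m] : Set X :=
  {x | IsPurelyAtomic (ergodicComponent G m x)}

/-- The orbital sum `∑ g, (d(g m)/dm)(x)` of Radon-Nikodym derivatives, with values in `[0, ∞]`;
`g m` is the image of `m` under `x ↦ g • x`. -/
noncomputable def orbitalSum (G : Type*) {X : Type*} [Group G] [MulAction G X]
    [MeasurableSpace X] (m : Measure X) (x : X) : ℝ≥0∞ :=
  ∑' g : G, (m.map (fun y : X => g • y)).rnDeriv m x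

/-! Write S for the orbital sum and m_x for the ergodic component of x. The chain rule for
Radon-Nikodym derivatives gives S(x) = (dg⁻¹m/dm)(x) S(gx), so {S = ∞} is invariant mod 0. Where S <
∞, giving gx the weight (dg⁻¹m/dm)(x)/S(x) defines a probability measure on the orbit, the same for
all points of that orbit. Mass transport shows that it integrates over invariant sets as m does, so
it is m_x, which is therefore atomic (`ergodicComponent_inter_eq_div`). Where S = ∞, m_x{g⁻¹y} =
(dgm/dm)(y) m_x{y}. An atom y would by freeness have distinct translates of total mass S(y) m_x{y} =
∞, yet m_x is a probability. A probability measure cannot be both atomic and non-atomic, so these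
two implications give both equalities. -/

/-- Two families of finite measures that agree almost everywhere on each measurable set of a
countably generated space agree almost everywhere. -/
theorem eventually_measure_eq_of_forall_measurableSet {α X : Type*} [MeasurableSpace X]
    [MeasurableSpace.CountablyGenerated X] {l : Filter α} [CountableInterFilter l]
    {μ ν : α → Measure X} [∀ a, IsFiniteMeasure (μ a)]
    (h : ∀ s, MeasurableSet s → ∀ᶠ a in l, μ a s = ν a s) : ∀ᶠ a in l, μ a = ν a := by
  set C := generateSetAlgebra (MeasurableSpace.countableGeneratingSet X) with hC
  have hgen : ‹MeasurableSpace X› = MeasurableSpace.generateFrom C := by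
    rw [hC, generateFrom_generateSetAlgebra_eq, MeasurableSpace.generateFrom_countableGeneratingSet]
  have hcount : C.Countable :=
    countable_generateSetAlgebra MeasurableSpace.countable_countableGeneratingSet
  have hpi : IsPiSystem C := fun s hs t ht _ =>
    isSetAlgebra_generateSetAlgebra.inter_mem hs ht
  have hmeas : ∀ s ∈ C, MeasurableSet s := fun s hs => by
    rw [hgen]; exact MeasurableSpace.measurableSet_generateFrom hs
  have hall : ∀ᶠ a in l, ∀ s ∈ C, μ a s = ν a s :=
    (eventually_countable_ball hcount).2 fun s hs => h s (hmeas s hs)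
  filter_upwards [hall, h Set.univ MeasurableSet.univ] with a ha hu
  exact ext_of_generate_finite C hgen hpi ha hu

/-! ### Disintegration over a sub-σ-algebra -/

section CondExpKernel

variable {X : Type*} {m' : MeasurableSpace X} [mX : MeasurableSpace X] [StandardBorelSpace X]
  {m : Measure X} [IsFiniteMeasure m]

/-- The trimmed measure composed with the kernel is the image of `m` under the diagonal map into (X,
`m'`) × X; integrate 1_C(x) h(y) against it. -/
theorem setLIntegral_lintegral_condExpKernel (hm : m' ≤ mX) {h : X → ℝ≥0∞} (hh : Measurable h)
    {C : Set X} (hC : MeasurableSet[m'] C) :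
    ∫⁻ x in C, ∫⁻ y, h y ∂condExpKernel m m' x ∂m = ∫⁻ x in C, h x ∂m := by
  have hmeas : Measurable[m'] fun x => ∫⁻ y, h y ∂condExpKernel m m' x :=
    hh.lintegral_kernel
  have h2 := @Measure.setLIntegral_compProd X X m' mX (m.trim hm) (condExpKernel m m') _ _
    (fun p => h p.2) (hh.comp (@measurable_snd X X m' mX)) C hC Set.univ MeasurableSet.univ
  simp only [Measure.restrict_univ] at h2
  rw [← setLIntegral_trim hm hmeas hC, ← h2, compProd_trim_condExpKernel hm]
  have hd : @Measurable X (X × X) mX (m'.prod mX) Function.diag :=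
    @Measurable.prodMk X mX X X m' mX _ _ (measurable_id'' hm) measurable_id
  have hCu : @MeasurableSet (X × X) (m'.prod mX) (C ×ˢ Set.univ) :=
    @MeasurableSet.prod X X m' mX _ _ hC MeasurableSet.univ
  refine (@setLIntegral_map X (X × X) mX (m'.prod mX) m (fun p => h p.2) _ _ hCu
    (hh.comp (@measurable_snd X X m' mX)) hd).trans ?_
  simp [Set.preimage, Function.diag]

/-- Uniqueness of conditional expectation for [0, ∞]-valued functions, with no integrability needed;
it serves to identify the conditional measures below. -/
theorem ae_eq_lintegral_condExpKernel (hm : m' ≤ mX) {u h : X → ℝ≥0∞} (hu : Measurable[m'] u)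
    (hh : Measurable h)
    (heq : ∀ C, MeasurableSet[m'] C → ∫⁻ x in C, u x ∂m = ∫⁻ x in C, h x ∂m) :
    u =ᵐ[m] fun x => ∫⁻ y, h y ∂condExpKernel m m' x := by
  have hmeas : Measurable[m'] fun x => ∫⁻ y, h y ∂condExpKernel m m' x :=
    hh.lintegral_kernel
  refine ae_eq_of_ae_eq_trim (hm := hm) ?_
  refine ae_eq_of_forall_setLIntegral_eq_of_sigmaFinite hu hmeas fun C hC _ => ?_
  rw [setLIntegral_trim hm hu hC, setLIntegral_trim hm hmeas hC, heq C hC,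
    setLIntegral_lintegral_condExpKernel hm hh hC]

theorem ae_ae_condExpKernel (hm : m' ≤ mX) {p : X → Prop} (hp : ∀ᵐ y ∂m, p y) :
    ∀ᵐ x ∂m, ∀ᵐ y ∂condExpKernel m m' x, p y := by
  refine ae_of_ae_trim hm (Measure.ae_ae_of_ae_comp ?_)
  rwa [condExpKernel_comp_trim hm]

theorem ae_condExpKernel_compl_eq_zero (hm : m' ≤ mX) {C : Set X} (hC : MeasurableSet[m'] C) :
    ∀ᵐ x ∂m, x ∈ C → condExpKernel m m' x Cᶜ = 0 := by
  have h := ae_eq_lintegral_condExpKernel (m := m) hm (u := Cᶜ.indicator 1) (h := Cᶜ.indicator 1)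
    ((@measurable_const ℝ≥0∞ X _ m' 1).indicator hC.compl)
    (measurable_one.indicator (hm _ hC).compl) fun _ _ => rfl
  filter_upwards [h] with x hx hxC
  rw [lintegral_indicator_one (hm _ hC).compl] at hx
  rw [← hx]; simp [hxC]

end CondExpKernel

/-! ### Change of variables and the Radon-Nikodym cocycle -/

section NonsingularAction

variable {G X : Type*} [Group G] [MulAction G X] [mX : MeasurableSpace X] {m : Measure X}

theorem invariantSets_le : invariantSets G m ≤ mX := fun _ hs => hs.1

theorem measurable_invariantSets {β : Type*} [MeasurableSpace β] {u : X → β} (hu : Measurable u)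
    (hinv : ∀ g : G, ∀ᵐ x ∂m, u (g • x) = u x) : Measurable[invariantSets G m] u := by
  refine fun s hs => ⟨hu hs, fun g => ?_⟩
  filter_upwards [hinv g] with x hx
  exact propext (show u (g • x) ∈ s ↔ u x ∈ s by rw [hx])

namespace IsNonsingularAction

theorem ae_smul (hns : IsNonsingularAction G m) (g : G) {p : X → Prop} (hp : ∀ᵐ x ∂m, p x) :
    ∀ᵐ x ∂m, p (g • x) :=
  ae_of_ae_map (hns.aemeasurable_smul g) ((hns.map_smul_absolutelyContinuous g).ae_le hp)

theorem aemeasurable_comp_smul (hns : IsNonsingularAction G m) (g : G) {β : Type*}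
    [MeasurableSpace β] {u : X → β} (hu : AEMeasurable u m) :
    AEMeasurable (fun x => u (g • x)) m :=
  (hu.mono_ac (hns.map_smul_absolutelyContinuous g)).comp_aemeasurable (hns.aemeasurable_smul g)

theorem absolutelyContinuous_map_smul (hns : IsNonsingularAction G m) (g : G) :
    m ≪ m.map (fun x : X => g • x) := by
  refine Measure.AbsolutelyContinuous.mk fun s hs h0 => ?_
  rw [Measure.map_apply_of_aemeasurable (hns.aemeasurable_smul g) hs, measure_eq_zero_iff_ae_notMem]
    at h0
  have := hns.ae_smul g⁻¹ h0
  rw [measure_eq_zero_iff_ae_notMem]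
  filter_upwards [this] with x hx
  simpa using hx

variable [IsFiniteMeasure m]

theorem lintegral_smul (hns : IsNonsingularAction G m) (g : G) {u : X → ℝ≥0∞}
    (hu : AEMeasurable u m) :
    ∫⁻ x, u (g • x) ∂m = ∫⁻ x, (m.map (fun y : X => g • y)).rnDeriv m x * u x ∂m := by
  have hac := hns.map_smul_absolutelyContinuous g
  rw [← lintegral_map' (hu.mono_ac hac) (hns.aemeasurable_smul g),
    ← Measure.withDensity_rnDeriv_eq _ _ hac,
    lintegral_withDensity_eq_lintegral_mul₀ (Measure.measurable_rnDeriv _ _).aemeasurable hu,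
    Measure.withDensity_rnDeriv_eq _ _ hac]
  rfl

theorem rnDeriv_pos (hns : IsNonsingularAction G m) (g : G) :
    ∀ᵐ x ∂m, 0 < (m.map (fun y : X => g • y)).rnDeriv m x :=
  Measure.rnDeriv_pos' (hns.absolutelyContinuous_map_smul g)

/-- Change of variables computes ∫ 1_s(abx) dm(x) in two ways: by ab at once, or by b and then a. -/
theorem rnDeriv_mul (hns : IsNonsingularAction G m) (a b : G) :
    ∀ᵐ x ∂m, (m.map (fun y : X => (a * b) • y)).rnDeriv m x =
      (m.map (fun y : X => a • y)).rnDeriv m x * (m.map (fun y : X => b • y)).rnDeriv m (a⁻¹ • x) := by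
  have hb : AEMeasurable (fun x => (m.map (fun y : X => b • y)).rnDeriv m (a⁻¹ • x)) m :=
    hns.aemeasurable_comp_smul a⁻¹ (Measure.measurable_rnDeriv _ _).aemeasurable
  refine ae_eq_of_forall_setLIntegral_eq_of_sigmaFinite₀
    (Measure.measurable_rnDeriv _ _).aemeasurable
    ((Measure.measurable_rnDeriv _ _).aemeasurable.mul hb) fun s hs _ => ?_
  have h1 : AEMeasurable (s.indicator (1 : X → ℝ≥0∞)) m :=
    (measurable_one.indicator hs).aemeasurable
  have hl := hns.lintegral_smul (a * b) h1
  have hr := hns.lintegral_smul b (hns.aemeasurable_comp_smul a h1)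
  have ha := hns.lintegral_smul a (hb.mul h1)
  simp only [Pi.mul_apply, inv_smul_smul] at ha
  simp only [mul_smul] at hl ⊢
  rw [← lintegral_indicator hs, ← lintegral_indicator hs]
  calc _ = _ := lintegral_congr fun x => ?_
    _ = _ := (hl.symm.trans hr).trans ha
    _ = _ := lintegral_congr fun x => ?_
  · by_cases hx : x ∈ s <;> simp [hx]
  · by_cases hx : x ∈ s <;> simp [hx]

end IsNonsingularAction

end NonsingularAction

/-! ### Orbital sums and mass transport -/

section OrbitalSum

variable {G X : Type*} [Group G] [MulAction G X] [mX : MeasurableSpace X]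
  {m : Measure X}

/-- The part of the orbital sum that comes from the group elements moving `x` into `s`. -/
noncomputable def orbitalSumOn (G : Type*) {X : Type*} [Group G] [MulAction G X]
    [MeasurableSpace X] (m : Measure X) (s : Set X) (x : X) : ℝ≥0∞ :=
  ∑' g : G, (m.map (fun y : X => g⁻¹ • y)).rnDeriv m x * s.indicator 1 (g • x)

theorem orbitalSumOn_univ (x : X) : orbitalSumOn G m Set.univ x = orbitalSum G m x := by
  simp only [orbitalSumOn, orbitalSum, Set.indicator_univ, Pi.one_apply, mul_one]
  exact (Equiv.inv G).tsum_eq fun g => (m.map (fun y : X => g • y)).rnDeriv m x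

theorem measurable_orbitalSum [Countable G] : Measurable (orbitalSum G m) :=
  Measurable.tsum fun _ => Measure.measurable_rnDeriv _ _

namespace IsNonsingularAction

theorem aemeasurable_orbitalSumOn [Countable G] (hns : IsNonsingularAction G m) {s : Set X}
    (hs : MeasurableSet s) : AEMeasurable (orbitalSumOn G m s) m :=
  AEMeasurable.tsum fun g => (Measure.measurable_rnDeriv _ _).aemeasurable.mul
    (hns.aemeasurable_comp_smul g (measurable_one.indicator hs).aemeasurable)

variable [IsFiniteMeasure m]

/-- Reindex by g ↦ gh in the cocycle identity. The factor does not depend on `s`, so it cancels in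
the ratio to the full orbital sum, which is thus invariant. -/
theorem orbitalSumOn_eq_mul [Countable G] (hns : IsNonsingularAction G m) (s : Set X) (h : G) :
    ∀ᵐ x ∂m, orbitalSumOn G m s x =
      (m.map (fun y : X => h⁻¹ • y)).rnDeriv m x * orbitalSumOn G m s (h • x) := by
  filter_upwards [ae_all_iff.2 fun g : G => hns.rnDeriv_mul h⁻¹ g⁻¹] with x hx
  rw [orbitalSumOn, orbitalSumOn, ← ENNReal.tsum_mul_left, ← (Equiv.mulRight h).tsum_eq]
  refine tsum_congr fun g => ?_
  simp only [Equiv.coe_mulRight, mul_inv_rev, hx g, inv_inv, mul_assoc]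
  rw [mul_smul]

theorem orbitalSum_eq_mul [Countable G] (hns : IsNonsingularAction G m) (h : G) :
    ∀ᵐ x ∂m, orbitalSum G m x =
      (m.map (fun y : X => h⁻¹ • y)).rnDeriv m x * orbitalSum G m (h • x) := by
  simpa only [orbitalSumOn_univ] using hns.orbitalSumOn_eq_mul Set.univ h

theorem orbitalSum_pos (hns : IsNonsingularAction G m) : ∀ᵐ x ∂m, 0 < orbitalSum G m x := by
  filter_upwards [hns.rnDeriv_pos (1 : G)] with x hx
  exact hx.trans_le (ENNReal.le_tsum (1 : G))

theorem measurableSet_orbitalSum_eq_top [Countable G] (hns : IsNonsingularAction G m) :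
    MeasurableSet[invariantSets G m] {x | orbitalSum G m x = ∞} := by
  refine ⟨measurable_orbitalSum (measurableSet_singleton ∞), fun g => ?_⟩
  filter_upwards [hns.orbitalSum_eq_mul g, hns.rnDeriv_pos g⁻¹,
    (m.map (fun y : X => g⁻¹ • y)).rnDeriv_lt_top m] with x hx h0 htop
  refine propext (show orbitalSum G m (g • x) = ∞ ↔ orbitalSum G m x = ∞ from ?_)
  rw [hx, ENNReal.mul_eq_top]
  simp [h0.ne', htop.ne]

/-- Mass transport: the orbitwise average of `1_s` with weights proportional to the Radon-Nikodym
cocycle has the same integrals as `1_s` on the invariant sets of finite orbital sum. -/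
theorem setLIntegral_orbitalSumOn_div [Countable G] (hns : IsNonsingularAction G m) {s C : Set X}
    (hs : MeasurableSet s) (hC : MeasurableSet[invariantSets G m] C) :
    ∫⁻ x in C, orbitalSumOn G m s x / orbitalSum G m x ∂m =
      ∫⁻ x in C, (s ∩ {x | orbitalSum G m x = ∞}ᶜ).indicator 1 x ∂m := by
  have hS : Measurable (orbitalSum G m) := measurable_orbitalSum
  have h1 : ∀ t : Set X, MeasurableSet t → AEMeasurable (t.indicator (1 : X → ℝ≥0∞)) m :=
    fun t ht => (measurable_one.indicator ht).aemeasurable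
  have hu : ∀ g : G, AEMeasurable (fun x => C.indicator (1 : X → ℝ≥0∞) x *
      (s.indicator 1 (g • x) / orbitalSum G m x)) m := fun g =>
    (h1 C hC.1).mul ((hns.aemeasurable_comp_smul g (h1 s hs)).div hS.aemeasurable)
  rw [← lintegral_indicator hC.1, ← lintegral_indicator hC.1]
  calc ∫⁻ x, C.indicator (fun x => orbitalSumOn G m s x / orbitalSum G m x) x ∂m
      = ∫⁻ x, ∑' g : G, (m.map (fun y : X => g⁻¹ • y)).rnDeriv m x *
          (C.indicator 1 x * (s.indicator 1 (g • x) / orbitalSum G m x)) ∂m := by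
        refine lintegral_congr fun x => ?_
        by_cases hx : x ∈ C
        · simp [hx, orbitalSumOn, div_eq_mul_inv, ← mul_assoc, ENNReal.tsum_mul_right]
        · simp [hx]
    _ = ∑' g : G, ∫⁻ x, C.indicator 1 (g⁻¹ • x) *
          (s.indicator 1 x / orbitalSum G m (g⁻¹ • x)) ∂m := by
        refine (lintegral_tsum fun g =>
          (Measure.measurable_rnDeriv _ _).aemeasurable.mul (hu g)).trans ?_
        refine tsum_congr fun g => ?_
        refine (hns.lintegral_smul g⁻¹ (hu g)).symm.trans ?_
        simp only [smul_inv_smul]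
    _ = ∑' g : G, ∫⁻ x, (m.map (fun y : X => g • y)).rnDeriv m x *
          (C.indicator 1 x * s.indicator 1 x / orbitalSum G m x) ∂m := by
        refine tsum_congr fun g => lintegral_congr_ae ?_
        -- The cocycle identity trades 1/S(g⁻¹x) for (dgm/dm)(x)/S(x), so that the sum over g
        -- rebuilds S(x).
        filter_upwards [hC.2 g⁻¹, hns.orbitalSum_eq_mul g⁻¹, hns.rnDeriv_pos g,
          (m.map (fun y : X => g • y)).rnDeriv_lt_top m] with x hx hSx h0 htop
        have hx' : g⁻¹ • x ∈ C ↔ x ∈ C := Iff.of_eq hx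
        rw [inv_inv] at hSx
        by_cases hxC : x ∈ C
        · simp only [hx'.2 hxC, hxC, Set.indicator_of_mem, Pi.one_apply, one_mul]
          rw [hSx, ← mul_div_assoc, ENNReal.mul_div_mul_left _ _ h0.ne' htop.ne]
        · simp [hx', hxC]
    _ = ∫⁻ x, orbitalSum G m x *
          (C.indicator 1 x * s.indicator 1 x / orbitalSum G m x) ∂m := by
        refine (lintegral_tsum fun g => (Measure.measurable_rnDeriv _ _).aemeasurable.mul
          (((h1 C hC.1).mul (h1 s hs)).div hS.aemeasurable)).symm.trans ?_
        simp only [Pi.mul_apply, Pi.div_apply, ENNReal.tsum_mul_right, orbitalSum]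
    _ = ∫⁻ x, C.indicator ((s ∩ {x | orbitalSum G m x = ∞}ᶜ).indicator 1) x ∂m := by
        refine lintegral_congr_ae ?_
        -- S · (1/S) is 1 where S is finite, but ∞ · 0 = 0 where S = ∞; hence the intersection with
        -- {S = ∞}ᶜ.
        filter_upwards [hns.orbitalSum_pos] with x hx
        by_cases hxC : x ∈ C <;> by_cases hxs : x ∈ s <;>
          by_cases hxS : orbitalSum G m x = ∞ <;>
          simp [hxC, hxs, hxS, ENNReal.mul_inv_cancel hx.ne']

end IsNonsingularAction

end OrbitalSum

/-! ### Atoms of the ergodic components -/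

section ErgodicComponent

variable {G X : Type*} [Group G] [MulAction G X] [mX : MeasurableSpace X]
  [StandardBorelSpace X] {m : Measure X} [IsFiniteMeasure m]

instance ergodicComponent.instIsProbabilityMeasure (x : X) : IsProbabilityMeasure (ergodicComponent G m x) :=
  inferInstanceAs (IsProbabilityMeasure (condExpKernel m (invariantSets G m) x))

namespace IsNonsingularAction

theorem ergodicComponent_inter_eq_div [Countable G] (hns : IsNonsingularAction G m) {s : Set X}
    (hs : MeasurableSet s) :
    ∀ᵐ x ∂m, ergodicComponent G m x (s ∩ {x | orbitalSum G m x = ∞}ᶜ) =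
      orbitalSumOn G m s x / orbitalSum G m x := by
  have hu : AEMeasurable (fun x => orbitalSumOn G m s x / orbitalSum G m x) m :=
    (hns.aemeasurable_orbitalSumOn hs).div measurable_orbitalSum.aemeasurable
  -- The ratio is only a.e. measurable, because the action is measurable only for the completion.
  -- Invariance mod 0 passes to the Borel version.
  have hinv : Measurable[invariantSets G m] (hu.mk _) := by
    refine measurable_invariantSets hu.measurable_mk fun g => ?_
    filter_upwards [hu.ae_eq_mk, hns.ae_smul g hu.ae_eq_mk, hns.orbitalSumOn_eq_mul s g,
      hns.orbitalSum_eq_mul g, hns.rnDeriv_pos g⁻¹,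
      (m.map (fun y : X => g⁻¹ • y)).rnDeriv_lt_top m] with x h1 h2 h3 h4 h5 h6
    rw [← h1, ← h2, h3, h4, ENNReal.mul_div_mul_left _ _ h5.ne' h6.ne]
  have hsA : MeasurableSet (s ∩ {x | orbitalSum G m x = ∞}ᶜ) :=
    hs.inter hns.measurableSet_orbitalSum_eq_top.1.compl
  have h := ae_eq_lintegral_condExpKernel (m := m) invariantSets_le hinv
    (measurable_one.indicator hsA) fun C hC => by
      rw [← hns.setLIntegral_orbitalSumOn_div hs hC]
      exact lintegral_congr_ae (ae_restrict_of_ae hu.ae_eq_mk.symm)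
  filter_upwards [h, hu.ae_eq_mk] with x hx hx'
  rw [hx', hx, lintegral_indicator_one hsA, ergodicComponent]

theorem isPurelyAtomic_ergodicComponent [Countable G] (hns : IsNonsingularAction G m) :
    ∀ᵐ x ∂m, orbitalSum G m x < ∞ → IsPurelyAtomic (ergodicComponent G m x) := by
  have hA := hns.measurableSet_orbitalSum_eq_top
  set A : Set X := {x | orbitalSum G m x = ∞}ᶜ with hAdef
  have hmeas := eventually_measure_eq_of_forall_measurableSet (l := ae m)
    (μ := fun x => (ergodicComponent G m x).restrict A)
    (ν := fun x => (orbitalSum G m x)⁻¹ • Measure.sum fun g : G =>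
      (m.map (fun y : X => g⁻¹ • y)).rnDeriv m x • Measure.dirac (g • x)) fun s hs => by
      filter_upwards [hns.ergodicComponent_inter_eq_div hs] with x hx
      rw [Measure.restrict_apply hs]
      refine hx.trans ?_
      simp [Measure.sum_apply _ hs, Measure.dirac_apply' _ hs, orbitalSumOn, div_eq_mul_inv,
        mul_comm]
  filter_upwards [hmeas, ae_condExpKernel_compl_eq_zero invariantSets_le hA.compl] with x hx hxA hxS
  have hc : (Set.range fun g : G => g • x).Countable := Set.countable_range _
  refine ⟨_, hc, ?_⟩
  have h0 : (ergodicComponent G m x).restrict A (Set.range fun g : G => g • x)ᶜ = 0 := by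
    rw [hx]
    simp [Measure.sum_apply _ hc.measurableSet.compl, Measure.dirac_apply' _ hc.measurableSet.compl]
  rw [Measure.restrict_apply hc.measurableSet.compl] at h0
  -- On A the component lives on the orbit of x; Aᶜ is null for it because x lies in the invariant
  -- set A.
  exact measure_mono_null (t := (_ ∩ A) ∪ Aᶜ) (fun y hy => by by_cases hyA : y ∈ A <;> simp_all)
    (measure_union_null h0 (hxA hxS.ne))

/-- Invariant sets are unmoved by g, so the change of variables for `m` localises to each of them
and hence to the components. A Borel version of the action of g is pushed forward. -/
theorem map_ergodicComponent (hns : IsNonsingularAction G m) (g : G) :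
    ∀ᵐ x ∂m, (ergodicComponent G m x).map ((hns.aemeasurable_smul g).mk _) =
      (ergodicComponent G m x).withDensity ((m.map (fun y : X => g • y)).rnDeriv m) := by
  set T := (hns.aemeasurable_smul g).mk with hT
  have hTm : Measurable T := (hns.aemeasurable_smul g).measurable_mk
  have hTe : (fun x => g • x) =ᵐ[m] T := (hns.aemeasurable_smul g).ae_eq_mk
  have hf := (m.map (fun y : X => g • y)).measurable_rnDeriv m
  refine eventually_measure_eq_of_forall_measurableSet fun s hs => ?_
  have h := ae_eq_lintegral_condExpKernel (m := m) (invariantSets_le (G := G))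
    (u := fun x => condExpKernel m (invariantSets G m) x (T ⁻¹' s))
    (measurable_condExpKernel (hTm hs)) (hf.indicator hs) fun C hC => by
      have hsm : MeasurableSet (C ∩ s) := hC.1.inter hs
      have h1 := setLIntegral_lintegral_condExpKernel (m := m) invariantSets_le
        (measurable_one.indicator (hTm hs)) hC
      simp only [lintegral_indicator_one (hTm hs)] at h1
      rw [h1, ← lintegral_indicator_one (hTm hs), ← lintegral_indicator hC.1, ← lintegral_indicator hC.1]
      refine Eq.trans (lintegral_congr_ae ?_) ((hns.lintegral_smul g
        (measurable_one.indicator hsm).aemeasurable).trans (lintegral_congr fun x => ?_))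
      · filter_upwards [hC.2 g, hTe] with x hx hxT
        have hx' : g • x ∈ C ↔ x ∈ C := Iff.of_eq hx
        by_cases h1 : x ∈ C <;> by_cases h2 : T x ∈ s <;> simp_all [Set.indicator]
      · by_cases h1 : x ∈ C <;> by_cases h2 : x ∈ s <;> simp [h1, h2]
  filter_upwards [h] with x hx
  rw [Measure.map_apply hTm hs, ergodicComponent, hx, withDensity_apply _ hs, lintegral_indicator hs]

/-- Equality of measures can be evaluated at every point, so one null set of x serves all y at once,
in particular all atoms. -/
theorem ergodicComponent_singleton_smul (hns : IsNonsingularAction G m) (g : G) :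
    ∀ᵐ x ∂m, ∀ y, ergodicComponent G m x {g⁻¹ • y} =
      (m.map (fun y : X => g • y)).rnDeriv m y * ergodicComponent G m x {y} := by
  filter_upwards [hns.map_ergodicComponent g, ae_ae_condExpKernel (invariantSets_le (G := G))
    (hns.aemeasurable_smul g).ae_eq_mk] with x hx hT y
  have h := congrArg (fun μ => μ {y}) hx
  simp only [Measure.map_apply (hns.aemeasurable_smul g).measurable_mk (measurableSet_singleton y),
    withDensity_apply _ (measurableSet_singleton y), lintegral_singleton] at h
  rw [← h]
  refine measure_congr ?_
  filter_upwards [hT] with z hz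
  refine propext (show z = g⁻¹ • y ↔ (hns.aemeasurable_smul g).mk _ z = y from ?_)
  rw [← hz, eq_inv_smul_iff]

theorem nullSingletonClass_ergodicComponent [Countable G] (hns : IsNonsingularAction G m)
    (hfree : IsFreeAction G m) :
    ∀ᵐ x ∂m, orbitalSum G m x = ∞ → NullSingletonClass (ergodicComponent G m x) := by
  filter_upwards [ae_all_iff.2 hns.ergodicComponent_singleton_smul,
    ae_ae_condExpKernel (invariantSets_le (G := G)) hfree,
    ae_condExpKernel_compl_eq_zero invariantSets_le hns.measurableSet_orbitalSum_eq_top]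
    with x hsmul hstab htop hx
  refine ⟨fun y => by_contra fun hy => ?_⟩
  -- Since y is an atom, whatever holds almost everywhere for the component holds at y itself.
  have hSy : orbitalSum G m y = ∞ := by
    by_contra hne
    exact hy (measure_mono_null (Set.singleton_subset_iff.2 hne) (htop hx))
  have hyfree : ∀ g : G, g • y = y → g = 1 := by
    by_contra hne
    exact hy (measure_mono_null (Set.singleton_subset_iff.2 hne) hstab)
  have hinj : Function.Injective fun g : G => g⁻¹ • y := fun a b hab => by
    have : (b * a⁻¹) • y = y := by
      rw [mul_smul, show a⁻¹ • y = b⁻¹ • y from hab, smul_inv_smul]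
    exact (mul_inv_eq_one.1 (hyfree _ this)).symm
  have hsum : ∑' g : G, ergodicComponent G m x {g⁻¹ • y} ≤ 1 := by
    rw [← measure_iUnion (fun a b hab => Set.disjoint_singleton.2 (hinj.ne hab))
      fun g => measurableSet_singleton _]
    exact prob_le_one
  simp only [hsmul, ENNReal.tsum_mul_right] at hsum
  change orbitalSum G m y * _ ≤ 1 at hsum
  rw [hSy, ENNReal.top_mul hy] at hsum
  exact absurd hsum (by simp)

end IsNonsingularAction

end ErgodicComponent

theorem IsPurelyAtomic.not_nullSingletonClass {X : Type*} [MeasurableSpace X] {μ : Measure X}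
    [NeZero μ] (h : IsPurelyAtomic μ) : ¬ NullSingletonClass μ := by
  intro _
  obtain ⟨S, hS, h0⟩ := h
  refine NeZero.ne μ (Measure.measure_univ_eq_zero.1 ?_)
  rw [← Set.union_compl_self S]
  exact measure_union_null (hS.measure_zero μ) h0

theorem mainTheorem4 {G X : Type*} [Group G] [Countable G] [MulAction G X]
    [MeasurableSpace X] [StandardBorelSpace X] (m : Measure X) [IsProbabilityMeasure m]
    (hns : IsNonsingularAction G m) (hfree : IsFreeAction G m) :
    continualPart G m =ᵐ[m] {x : X | orbitalSum G m x = ∞} ∧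
      discontinualPart G m =ᵐ[m] {x : X | orbitalSum G m x < ∞} := by
  have hexcl : ∀ x, IsPurelyAtomic (ergodicComponent G m x) →
      ¬ NullSingletonClass (ergodicComponent G m x) := fun x h => h.not_nullSingletonClass
  have hC := hns.nullSingletonClass_ergodicComponent hfree
  have hD := hns.isPurelyAtomic_ergodicComponent
  constructor
  · filter_upwards [hC, hD] with x h1 h2
    exact propext ⟨fun h => by_contra fun hne => hexcl x (h2 (lt_top_iff_ne_top.2 hne)) h, h1⟩
  · filter_upwards [hC, hD] with x h1 h2
    exact propext ⟨fun h => lt_top_iff_ne_top.2 fun he => hexcl x h (h1 he), h2⟩
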